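/- Let $b,k_1,k_2,k_3>0$ be constants and let $v_{\rm ref},\omega_{\rm ref},a_l,a_r$ be continuously differentiable, bounded real functions on $[0,\infty)$ such that, for some constants $\mu_1,\mu_2>0$ and all $t\ge 0$, $a_l(t)\ge 1$, $a_r(t)\ge 1$, $v_{\rm ref}(t)\ge\mu_1$, $|2v_{\rm ref}(t)+b\,\omega_{\rm ref}(t)|\ge\mu_2$ and $|2v_{\rm ref}(t)-b\,\omega_{\rm ref}(t)|\ge\mu_2$. For $\gamma_1,\gamma_2>0$ consider the nominal closed-loop augmented error dynamics $\dot e_a=f_a(t,e_a)$, $e_a=(e_1,e_2,e_3,\tilde a_l,\tilde a_r)^T$, where $$f_a(t,e_a)=\begin{pmatrix}\Delta_r\Omega_3\Omega_1+v_{\rm ref}\cos e_3-\Delta_l\Omega_4\Omega_2\\ \Delta_l\Omega_2\frac{e_1}{b}+v_{\rm ref}\sin e_3-\Delta_r\Omega_1\frac{e_1}{b}\\ \omega_{\rm ref}-\frac1b\Delta_r\Omega_1+\frac1b\Delta_l\Omega_2\\ \gamma_1\Omega_2\left[\Omega_4e_1-\left(\frac{e_1}{b}+\frac{k_3}{b}\right)(e_2+k_3e_3)-\frac{1}{bk_2}\sin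 e_3\right]\\ \gamma_2\Omega_1\left[-\Omega_3e_1+\left(\frac{e_1}{b}+\frac{k_3}{b}\right)(e_2+k_3e_3)+\frac{1}{bk_2}\sin e_3\right]\end{pmatrix},$$ $\Delta_r=1+\tilde a_r/a_r$, $\Delta_l=1+\tilde a_l/a_l$, $\Omega_1=v_c+\frac b2\omega_c$, $\Omega_2=v_c-\frac b2\omega_c$, $\Omega_3=\frac{e_2}{b}-\frac12$, $\Omega_4=\frac{e_2}{b}+\frac12$, $\omega_c=\omega_{\rm ref}+\frac{v_{\rm ref}}2\left[k_2(e_2+k_3e_3)+\frac1{k_3}\sin e_3\right]$, $v_c=v_{\rm ref}\cos e_3-k_3e_3\omega_c+k_1e_1$. Then: (a) For all $\gamma_1,\gamma_2>0$ and $t\ge 0$, the Jacobian of $f_a(t,\cdot)$ at $e_a=0$ is, with $v_1=b\omega_{\rm ref}+2v_{\rm ref}$, $v_2=b\omega_{\rm ref}-2v_{\rm ref}$ and $k_4=1+k_2k_3^2$, $$A(t)=\begin{pmatrix}-k_1&\omega_{\rm ref}&k_3\omega_{\rm ref}&\frac{v_2}{4a_l}&-\frac{v_1}{4a_r}\\ -\omega_{\rm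 ref}&0&v_{\rm ref}&0&0\\ 0&-\frac{k_2}{2}v_{\rm ref}&-\frac{k_4}{2k_3}v_{\rm ref}&-\frac{v_2}{2ba_l}&-\frac{v_1}{2ba_r}\\ -\frac{\gamma_1v_2}{4}&\frac{k_3\gamma_1v_2}{2b}&\frac{\gamma_1k_4v_2}{2bk_2}&0&0\\ \frac{\gamma_2v_1}{4}&\frac{k_3\gamma_2v_1}{2b}&\frac{\gamma_2k_4v_1}{2bk_2}&0&0\end{pmatrix}.$$ (b) For all sufficiently small $\gamma_1,\gamma_2>0$ the eigenvalues of $A(t)$ have real parts bounded away from zero uniformly in $t$: there is $\gamma_0>0$ such that for all $\gamma_1,\gamma_2\in(0,\gamma_0)$ there is $\epsilon>0$ with $$\operatorname{Re}\lambda\le-\epsilon<0\quad\text{for every } t\ge 0 \text{ and every complex eigenvalue } \lambda \text{ of } A(t).$$ -/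

import Mathlib

open Set

noncomputable section

namespace SlipRobot

/-- The angular component `ω_c` of the kinematic control law, as a function of the current reference
velocities `v = v_ref(t)`, `ω = ω_ref(t)` and of the pose error `(e₁, e₂, e₃)`. -/
def omegaC (k₂ k₃ v ω e₂ e₃ : ℝ) : ℝ :=
  ω + v / 2 * (k₂ * (e₂ + k₃ * e₃) + 1 / k₃ * Real.sin e₃)

/-- The linear component `v_c` of the kinematic control law. -/
def vC (k₁ k₂ k₃ v ω e₁ e₂ e₃ : ℝ) : ℝ :=
  v * Real.cos e₃ - k₃ * e₃ * omegaC k₂ k₃ v ω e₂ e₃ + k₁ * e₁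

/-- The nominal closed-loop vector field `f_a(t, e_a)`, with augmented error
`x = e_a = (e₁, e₂, e₃, ã_l, ã_r)`. -/
def nominalField (b k₁ k₂ k₃ γ₁ γ₂ : ℝ) (vref ωref al ar : ℝ → ℝ) (t : ℝ)
    (x : Fin 5 → ℝ) : Fin 5 → ℝ :=
  let e₁ := x 0
  let e₂ := x 1
  let e₃ := x 2
  let ωc := omegaC k₂ k₃ (vref t) (ωref t) e₂ e₃
  let vc := vC k₁ k₂ k₃ (vref t) (ωref t) e₁ e₂ e₃
  let Δl := 1 + x 3 / al t
  let Δr := 1 + x 4 / ar t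
  let Ω₁ := vc + b / 2 * ωc
  let Ω₂ := vc - b / 2 * ωc
  let Ω₃ := e₂ / b - 1 / 2
  let Ω₄ := e₂ / b + 1 / 2
  ![Δr * Ω₃ * Ω₁ + vref t * Real.cos e₃ - Δl * Ω₄ * Ω₂,
    Δl * Ω₂ * (e₁ / b) + vref t * Real.sin e₃ - Δr * Ω₁ * (e₁ / b),
    ωref t - 1 / b * Δr * Ω₁ + 1 / b * Δl * Ω₂,
    γ₁ * Ω₂ * (Ω₄ * e₁ - (e₁ / b + k₃ / b) * (e₂ + k₃ * e₃) - 1 / (b * k₂) * Real.sin e₃),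
    γ₂ * Ω₁ * (-Ω₃ * e₁ + (e₁ / b + k₃ / b) * (e₂ + k₃ * e₃) + 1 / (b * k₂) * Real.sin e₃)]

/-- The explicit matrix `A(t)` of the linearization of the nominal system at the origin, with
`v₁ = b ω_ref + 2 v_ref`, `v₂ = b ω_ref - 2 v_ref`, `k₄ = 1 + k₂ k₃²`. -/
def linMatrix (b k₁ k₂ k₃ γ₁ γ₂ : ℝ) (vref ωref al ar : ℝ → ℝ) (t : ℝ) :
    Matrix (Fin 5) (Fin 5) ℝ :=
  let v₁ := b * ωref t + 2 * vref t
  let v₂ := b * ωref t - 2 * vref t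
  let k₄ := 1 + k₂ * k₃ ^ 2
  let c := 1 / (4 * b * al t * ar t)
  let d := 1 / (4 * b * k₂)
  !![-k₁, ωref t, k₃ * ωref t, c * (b * ar t * v₂), c * (-b * al t * v₁);
     -ωref t, 0, vref t, 0, 0;
     0, -(k₂ / 2) * vref t, -(k₄ / (2 * k₃)) * vref t, c * (-2 * ar t * v₂), c * (-2 * al t * v₁);
     d * (-b * k₂ * γ₁ * v₂), d * (2 * k₂ * k₃ * γ₁ * v₂), d * (2 * γ₁ * k₄ * v₂), 0, 0;
     d * (b * k₂ * γ₂ * v₁), d * (2 * k₂ * k₃ * γ₂ * v₁), d * (2 * γ₂ * k₄ * v₁), 0, 0]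

/-- A real signal is bounded on the time axis `[0, ∞)`. -/
def BoundedSignal (f : ℝ → ℝ) : Prop := ∃ M : ℝ, ∀ t : ℝ, 0 ≤ t → |f t| ≤ M

/-- The standing assumptions on the constants `b, k₁, k₂, k₃` and on the signals
`v_ref, ω_ref, a_l, a_r` on the time axis `[0, ∞)`. -/
structure StandingAssumption (b k₁ k₂ k₃ : ℝ) (vref ωref al ar : ℝ → ℝ) : Prop where
  b_pos : 0 < b
  k₁_pos : 0 < k₁
  k₂_pos : 0 < k₂
  k₃_pos : 0 < k₃
  vref_C1 : ContDiffOn ℝ 1 vref (Ici 0)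
  ωref_C1 : ContDiffOn ℝ 1 ωref (Ici 0)
  al_C1 : ContDiffOn ℝ 1 al (Ici 0)
  ar_C1 : ContDiffOn ℝ 1 ar (Ici 0)
  one_le_al : ∀ t : ℝ, 0 ≤ t → 1 ≤ al t
  one_le_ar : ∀ t : ℝ, 0 ≤ t → 1 ≤ ar t
  vref_lower : ∃ μ₁ : ℝ, 0 < μ₁ ∧ ∀ t : ℝ, 0 ≤ t → μ₁ ≤ vref t
  wheel_lower : ∃ μ₂ : ℝ, 0 < μ₂ ∧ ∀ t : ℝ, 0 ≤ t →
    μ₂ ≤ |2 * vref t + b * ωref t| ∧ μ₂ ≤ |2 * vref t - b * ωref t|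
  vref_bdd : BoundedSignal vref
  ωref_bdd : BoundedSignal ωref
  al_bdd : BoundedSignal al
  ar_bdd : BoundedSignal ar

end SlipRobot

end

/-! The linearized error dynamics at a frozen time carries an exact Lyapunov function: the quadratic
form
`e₁² + (e₂ + k₃ e₃)² + e₃² / k₂ + ã_l² / (γ₁ a_l) + ã_r² / (γ₂ a_r)`.
In its derivative along
`A(t)` all the terms coupling the pose error to `(ã_l, ã_r)` cancel, and what is left is
`-k₁ e₁² - (k₂ k₃ v / 2) (e₂ + k₃ e₃)² - v / (2 k₂ k₃) e₃²` (up to a factor `2`), see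
`lyapunovForm_mulVec`. So no eigenvalue has positive real part. For an eigenvector with
`Re z = 0` the pose components vanish, and the first and third rows of the eigenvalue equation
become two independent linear equations for `(ã_l, ã_r)`, because `b ω ± 2 v ≠ 0`; so the eigenvector
is zero. Hence `Re z < 0`, for all gains and not only small ones (`re_neg_of_mulVec_eq`).

Uniformity in time comes from compactness. Since the signals are bounded and the lower bounds are
uniform, the values `(v_ref, ω_ref, 1 / a_l, 1 / a_r)` stay in a compact set on which the above
applies. The triples (parameter, unit eigenvector, eigenvalue) over it form a compact set, and the
continuous function `Re z` attains a maximum there, which is negative (`exists_uniform_re_bound`).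

The Jacobian is computed componentwise by the product rule. -/

open Matrix

namespace SlipRobot

/-! ### The linearization in terms of the current signal values -/

/-- The matrix `A` as a function of the current values `v`, `ω` of the reference velocities and
of the inverses `α = 1 / a_l`, `β = 1 / a_r` of the slip parameters. With the inverses as
parameters, the entries are polynomials, hence continuous everywhere. -/
noncomputable def frozenMatrix (b k₁ k₂ k₃ γ₁ γ₂ v ω α β : ℝ) : Matrix (Fin 5) (Fin 5) ℝ :=
  let v₁ := b * ω + 2 * v
  let v₂ := b * ω - 2 * v
  let k₄ := 1 + k₂ * k₃ ^ 2
  !![-k₁, ω, k₃ * ω, α * v₂ / 4, -(β * v₁ / 4);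
     -ω, 0, v, 0, 0;
     0, -(k₂ * v / 2), -(k₄ / (2 * k₃) * v), -(α * v₂ / (2 * b)), -(β * v₁ / (2 * b));
     -(γ₁ * v₂ / 4), k₃ * γ₁ * v₂ / (2 * b), γ₁ * k₄ * v₂ / (2 * b * k₂), 0, 0;
     γ₂ * v₁ / 4, k₃ * γ₂ * v₁ / (2 * b), γ₂ * k₄ * v₁ / (2 * b * k₂), 0, 0]

lemma linMatrix_eq_frozenMatrix {b k₁ k₂ k₃ γ₁ γ₂ : ℝ} {vref ωref al ar : ℝ → ℝ} {t : ℝ}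
    (hb : b ≠ 0) (hk₂ : k₂ ≠ 0) (hl : al t ≠ 0) (hr : ar t ≠ 0) :
    linMatrix b k₁ k₂ k₃ γ₁ γ₂ vref ωref al ar t =
      frozenMatrix b k₁ k₂ k₃ γ₁ γ₂ (vref t) (ωref t) (al t)⁻¹ (ar t)⁻¹ := by
  ext i j
  fin_cases i <;> fin_cases j <;> simp [linMatrix, frozenMatrix] <;> field_simp <;> norm_num

/-! ### The Jacobian at the origin -/

theorem hasFDerivAt_nominalField {b k₁ k₂ k₃ γ₁ γ₂ : ℝ} {vref ωref al ar : ℝ → ℝ} {t : ℝ}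
    (hb : b ≠ 0) (hk₂ : k₂ ≠ 0) (hk₃ : k₃ ≠ 0) (hl : al t ≠ 0) (hr : ar t ≠ 0) :
    HasFDerivAt (nominalField b k₁ k₂ k₃ γ₁ γ₂ vref ωref al ar t)
      (LinearMap.toContinuousLinearMap
        (Matrix.toLin' (linMatrix b k₁ k₂ k₃ γ₁ γ₂ vref ωref al ar t))) (0 : Fin 5 → ℝ) := by
  rw [linMatrix_eq_frozenMatrix hb hk₂ hl hr]
  have hx (i : Fin 5) : HasFDerivAt (fun x : Fin 5 → ℝ => x i)
      (ContinuousLinearMap.proj (R := ℝ) (φ := fun _ : Fin 5 => ℝ) i) 0 := hasFDerivAt_apply i 0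
  have hsin := (hx 2).sin
  have hcos := (hx 2).cos
  have hs := (hx 1).add ((hx 2).const_mul k₃)
  have hωc := (((hs.const_mul k₂).add (hsin.const_mul (1 / k₃))).const_mul
    (vref t / 2)).const_add (ωref t)
  have hvc := ((hcos.const_mul (vref t)).sub (((hx 2).const_mul k₃).mul hωc)).add
    ((hx 0).const_mul k₁)
  have hΔl := ((hx 3).mul_const (al t)⁻¹).const_add 1
  have hΔr := ((hx 4).mul_const (ar t)⁻¹).const_add 1
  have hΩ₁ := hvc.add (hωc.const_mul (b / 2))
  have hΩ₂ := hvc.sub (hωc.const_mul (b / 2))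
  have hΩ₃ := ((hx 1).mul_const b⁻¹).sub_const (1 / 2)
  have hΩ₄ := ((hx 1).mul_const b⁻¹).add_const (1 / 2)
  have he := (hx 0).mul_const b⁻¹
  have hg := ((he.add_const (k₃ / b)).mul hs)
  have hh := hsin.const_mul (1 / (b * k₂))
  rw [hasFDerivAt_pi']
  intro i
  fin_cases i
  · refine (((((hΔr.mul hΩ₃).mul hΩ₁).add (hcos.const_mul (vref t))).sub
      ((hΔl.mul hΩ₄).mul hΩ₂)).congr_fderiv ?_)
    ext y
    simp [frozenMatrix, dotProduct, Fin.sum_univ_five]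
    field_simp
    ring
  · refine (((((hΔl.mul hΩ₂).mul he).add (hsin.const_mul (vref t))).sub
      ((hΔr.mul hΩ₁).mul he)).congr_fderiv ?_)
    ext y
    simp [frozenMatrix, dotProduct, Fin.sum_univ_five]
    field_simp
    ring
  · refine ((((((hΔr.const_mul (1 / b)).mul hΩ₁).const_sub (ωref t))).add
      ((hΔl.const_mul (1 / b)).mul hΩ₂)).congr_fderiv ?_)
    ext y
    simp [frozenMatrix, dotProduct, Fin.sum_univ_five]
    field_simp
    ring
  · refine (((hΩ₂.const_mul γ₁).mul (((hΩ₄.mul (hx 0)).sub hg).sub hh)).congr_fderiv ?_)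
    ext y
    simp [frozenMatrix, dotProduct, Fin.sum_univ_five]
    field_simp
    ring
  · refine (((hΩ₁.const_mul γ₂).mul (((hΩ₃.neg.mul (hx 0)).add hg).add hh)).congr_fderiv ?_)
    ext y
    simp [frozenMatrix, dotProduct, Fin.sum_univ_five]
    field_simp
    ring

/-! ### The Lyapunov form -/

/-- The symmetric bilinear form whose quadratic form is the Lyapunov function. -/
noncomputable def lyapunovForm (k₂ k₃ γ₁ γ₂ α β : ℝ) (x y : Fin 5 → ℝ) : ℝ :=
  x 0 * y 0 + (x 1 + k₃ * x 2) * (y 1 + k₃ * y 2) + x 2 * y 2 / k₂ + α * (x 3 * y 3) / γ₁ +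
    β * (x 4 * y 4) / γ₂

/-- Half the rate of dissipation of the Lyapunov function. It sees the pose error only. -/
noncomputable def dissipation (k₁ k₂ k₃ v : ℝ) (x : Fin 5 → ℝ) : ℝ :=
  k₁ * x 0 ^ 2 + k₂ * k₃ * v / 2 * (x 1 + k₃ * x 2) ^ 2 + v / (2 * k₂ * k₃) * x 2 ^ 2

lemma lyapunovForm_mulVec {b k₁ k₂ k₃ γ₁ γ₂ : ℝ} (v ω α β : ℝ) (hb : b ≠ 0) (hk₂ : k₂ ≠ 0)
    (hk₃ : k₃ ≠ 0) (hγ₁ : γ₁ ≠ 0) (hγ₂ : γ₂ ≠ 0) (x : Fin 5 → ℝ) :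
    lyapunovForm k₂ k₃ γ₁ γ₂ α β x (frozenMatrix b k₁ k₂ k₃ γ₁ γ₂ v ω α β *ᵥ x) =
      -dissipation k₁ k₂ k₃ v x := by
  simp [lyapunovForm, dissipation, frozenMatrix, Matrix.mulVec, dotProduct, Fin.sum_univ_five]
  field_simp
  ring

lemma lyapunovForm_self_nonneg {k₂ k₃ γ₁ γ₂ α β : ℝ} (hk₂ : 0 < k₂) (hγ₁ : 0 < γ₁)
    (hγ₂ : 0 < γ₂) (hα : 0 < α) (hβ : 0 < β) (x : Fin 5 → ℝ) :
    0 ≤ lyapunovForm k₂ k₃ γ₁ γ₂ α β x x := by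
  simp only [lyapunovForm, ← pow_two]
  positivity

lemma dissipation_nonneg {k₁ k₂ k₃ v : ℝ} (hk₁ : 0 < k₁) (hk₂ : 0 < k₂) (hk₃ : 0 < k₃)
    (hv : 0 < v) (x : Fin 5 → ℝ) : 0 ≤ dissipation k₁ k₂ k₃ v x := by
  unfold dissipation
  positivity

lemma pose_eq_zero_of_dissipation_nonpos {k₁ k₂ k₃ v : ℝ} (hk₁ : 0 < k₁) (hk₂ : 0 < k₂)
    (hk₃ : 0 < k₃) (hv : 0 < v) {x : Fin 5 → ℝ} (hx : dissipation k₁ k₂ k₃ v x ≤ 0) :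
    x 0 = 0 ∧ x 1 = 0 ∧ x 2 = 0 := by
  unfold dissipation at hx
  have h₀ : 0 ≤ k₁ * x 0 ^ 2 := by positivity
  have h₁ : 0 ≤ k₂ * k₃ * v / 2 * (x 1 + k₃ * x 2) ^ 2 := by positivity
  have h₂ : 0 ≤ v / (2 * k₂ * k₃) * x 2 ^ 2 := by positivity
  have e₀ : k₁ * x 0 ^ 2 = 0 := by linarith
  have e₁ : k₂ * k₃ * v / 2 * (x 1 + k₃ * x 2) ^ 2 = 0 := by linarith
  have e₂ : v / (2 * k₂ * k₃) * x 2 ^ 2 = 0 := by linarith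
  have z₀ : x 0 = 0 := by simpa [hk₁.ne'] using e₀
  have z₂ : x 2 = 0 := by simpa [hk₂.ne', hk₃.ne', hv.ne'] using e₂
  have z₁ : x 1 = 0 := by simpa [hk₂.ne', hk₃.ne', hv.ne', z₂] using e₁
  exact ⟨z₀, z₁, z₂⟩

/-! ### Eigenvalues at a fixed time -/

theorem re_neg_of_mulVec_eq {b k₁ k₂ k₃ γ₁ γ₂ v ω α β : ℝ} (hb : 0 < b) (hk₁ : 0 < k₁)
    (hk₂ : 0 < k₂) (hk₃ : 0 < k₃) (hγ₁ : 0 < γ₁) (hγ₂ : 0 < γ₂) (hv : 0 < v) (hα : 0 < α)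
    (hβ : 0 < β) (h₁ : 2 * v + b * ω ≠ 0) (h₂ : 2 * v - b * ω ≠ 0) {x : Fin 5 → ℂ} (hx : x ≠ 0)
    {z : ℂ}
    (h : (frozenMatrix b k₁ k₂ k₃ γ₁ γ₂ v ω α β).map (fun r : ℝ => (r : ℂ)) *ᵥ x = z • x) :
    z.re < 0 := by
  by_contra! hz
  set A := frozenMatrix b k₁ k₂ k₃ γ₁ γ₂ v ω α β with hA
  set B := lyapunovForm k₂ k₃ γ₁ γ₂ α β with hB
  set u : Fin 5 → ℝ := fun i => (x i).re with hu
  set w : Fin 5 → ℝ := fun i => (x i).im with hw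
  have hAu : A *ᵥ u = z.re • u - z.im • w := by
    ext i
    simpa [Matrix.mulVec, dotProduct, hu, hw] using congrArg Complex.re (congrFun h i)
  have hAw : A *ᵥ w = z.re • w + z.im • u := by
    ext i
    simpa [Matrix.mulVec, dotProduct, hu, hw] using congrArg Complex.im (congrFun h i)
  have hLu := lyapunovForm_mulVec (k₁ := k₁) v ω α β hb.ne' hk₂.ne' hk₃.ne' hγ₁.ne' hγ₂.ne' u
  have hLw := lyapunovForm_mulVec (k₁ := k₁) v ω α β hb.ne' hk₂.ne' hk₃.ne' hγ₁.ne' hγ₂.ne' w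
  rw [← hA, hAu, ← hB] at hLu
  rw [← hA, hAw, ← hB] at hLw
  -- The imaginary part of `z` drops out of the sum because the form is symmetric.
  have hsum : B u (z.re • u - z.im • w) + B w (z.re • w + z.im • u) =
      z.re * (B u u + B w w) := by
    simp only [hB, lyapunovForm, Pi.add_apply, Pi.sub_apply, Pi.smul_apply, smul_eq_mul]
    ring
  have hBu : 0 ≤ B u u := lyapunovForm_self_nonneg hk₂ hγ₁ hγ₂ hα hβ u
  have hBw : 0 ≤ B w w := lyapunovForm_self_nonneg hk₂ hγ₁ hγ₂ hα hβ w
  have hDu := dissipation_nonneg hk₁ hk₂ hk₃ hv u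
  have hDw := dissipation_nonneg hk₁ hk₂ hk₃ hv w
  have hpos := mul_nonneg hz (add_nonneg hBu hBw)
  obtain ⟨u₀, u₁, u₂⟩ := pose_eq_zero_of_dissipation_nonpos hk₁ hk₂ hk₃ hv
    (x := u) (by linarith)
  obtain ⟨w₀, w₁, w₂⟩ := pose_eq_zero_of_dissipation_nonpos hk₁ hk₂ hk₃ hv
    (x := w) (by linarith)
  -- If the pose components of `y` vanish, the first and third rows determine the other two.
  have key (y : Fin 5 → ℝ) (y₀ : y 0 = 0) (y₁ : y 1 = 0) (y₂ : y 2 = 0)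
      (r₀ : (A *ᵥ y) 0 = 0) (r₂ : (A *ᵥ y) 2 = 0) : y 3 = 0 ∧ y 4 = 0 := by
    simp [hA, frozenMatrix, Matrix.mulVec, dotProduct, Fin.sum_univ_five, y₀, y₁, y₂] at r₀ r₂
    field_simp at r₀ r₂
    have e₃ : α * (2 * v - b * ω) * y 3 = 0 := by linarith
    have e₄ : β * (2 * v + b * ω) * y 4 = 0 := by linarith
    exact ⟨by simpa [hα.ne', h₂] using e₃, by simpa [hβ.ne', h₁] using e₄⟩
  obtain ⟨u₃, u₄⟩ := key u u₀ u₁ u₂ (by simp [hAu, u₀, w₀]) (by simp [hAu, u₂, w₂])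
  obtain ⟨w₃, w₄⟩ := key w w₀ w₁ w₂ (by simp [hAw, u₀, w₀]) (by simp [hAw, u₂, w₂])
  apply hx
  ext i
  fin_cases i
  exacts [Complex.ext u₀ w₀, Complex.ext u₁ w₁, Complex.ext u₂ w₂, Complex.ext u₃ w₃,
    Complex.ext u₄ w₄]

/-! ### Uniformity in time -/

/-- A continuous family of complex matrices, all of whose eigenvalues have negative real parts,
has its spectra uniformly bounded away from the imaginary axis on a compact set. -/
theorem exists_uniform_re_bound {X n : Type*} [TopologicalSpace X] [Fintype n]
    {K : Set X} (hK : IsCompact K) {A : X → Matrix n n ℂ} (hA : Continuous A)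
    (hneg : ∀ p ∈ K, ∀ x : n → ℂ, x ≠ 0 → ∀ z : ℂ, A p *ᵥ x = z • x → z.re < 0) :
    ∃ ε : ℝ, 0 < ε ∧ ∀ p ∈ K, ∀ x : n → ℂ, x ≠ 0 → ∀ z : ℂ, A p *ᵥ x = z • x → z.re ≤ -ε := by
  have hKS := hK.prod (isCompact_sphere (0 : n → ℂ) 1)
  have hmul : Continuous fun q : X × (n → ℂ) => A q.1 *ᵥ q.2 :=
    (hA.comp continuous_fst).matrix_mulVec continuous_snd
  -- For a unit eigenvector `x` the eigenvalue has norm `‖A x‖`, so the eigenvalues are bounded.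
  obtain ⟨R, hR⟩ := hKS.exists_bound_of_continuousOn hmul.continuousOn
  let C : Set ((X × (n → ℂ)) × ℂ) :=
    (K ×ˢ Metric.sphere 0 1) ×ˢ Metric.closedBall 0 R ∩ {q | A q.1.1 *ᵥ q.1.2 = q.2 • q.1.2}
  have hC : IsCompact C := (hKS.prod (isCompact_closedBall 0 R)).inter_right
    (isClosed_eq (hmul.comp continuous_fst) (by fun_prop))
  have hmem (p : X) (hp : p ∈ K) (x : n → ℂ) (hx : x ≠ 0) (z : ℂ) (h : A p *ᵥ x = z • x) :
      ((p, (‖x‖⁻¹ : ℂ) • x), z) ∈ C := by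
    have hx' : ‖x‖ ≠ 0 := norm_ne_zero_iff.mpr hx
    have hnorm : ‖(‖x‖⁻¹ : ℂ) • x‖ = 1 := by simp [norm_smul, hx']
    have heig : A p *ᵥ ((‖x‖⁻¹ : ℂ) • x) = z • ((‖x‖⁻¹ : ℂ) • x) := by
      rw [Matrix.mulVec_smul, h, smul_comm]
    have hS : (p, (‖x‖⁻¹ : ℂ) • x) ∈ K ×ˢ Metric.sphere (0 : n → ℂ) 1 :=
      ⟨hp, by simpa using hnorm⟩
    refine ⟨⟨hS, ?_⟩, heig⟩
    have := hR _ hS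
    rw [heig, norm_smul, hnorm, mul_one] at this
    simpa using this
  rcases C.eq_empty_or_nonempty with hempty | hne
  · refine ⟨1, one_pos, fun p hp x hx z h => ?_⟩
    have := hmem p hp x hx z h
    simp [hempty] at this
  · obtain ⟨⟨⟨p₀, x₀⟩, z₀⟩, hq, hmax⟩ :=
      hC.exists_isMaxOn hne (f := fun q => q.2.re) (by fun_prop)
    have hx₀ : x₀ ≠ 0 := by
      rintro rfl
      simpa using hq.1.1.2
    refine ⟨-z₀.re, neg_pos.mpr (hneg p₀ hq.1.1.1 x₀ hx₀ z₀ hq.2), fun p hp x hx z h => ?_⟩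
    simpa using hmax (hmem p hp x hx z h)

lemma continuous_frozenMatrix (b k₁ k₂ k₃ γ₁ γ₂ : ℝ) :
    Continuous fun p : ℝ × ℝ × ℝ × ℝ =>
      (frozenMatrix b k₁ k₂ k₃ γ₁ γ₂ p.1 p.2.1 p.2.2.1 p.2.2.2).map (fun r : ℝ => (r : ℂ)) := by
  refine Continuous.matrix_map (continuous_matrix fun i j => ?_) Complex.continuous_ofReal
  fin_cases i <;> fin_cases j <;> simp [frozenMatrix] <;> fun_prop

/-- The parameter values `(v, ω, 1 / a_l, 1 / a_r)` allowed by given uniform bounds. -/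
def parameterSet (b μ₁ μ₂ Mv Mω Ml Mr : ℝ) : Set (ℝ × ℝ × ℝ × ℝ) :=
  (Icc μ₁ Mv ×ˢ Icc (-Mω) Mω ×ˢ Icc Ml⁻¹ 1 ×ˢ Icc Mr⁻¹ 1) ∩
    ({p | μ₂ ≤ |2 * p.1 + b * p.2.1|} ∩ {p | μ₂ ≤ |2 * p.1 - b * p.2.1|})

lemma isCompact_parameterSet (b μ₁ μ₂ Mv Mω Ml Mr : ℝ) :
    IsCompact (parameterSet b μ₁ μ₂ Mv Mω Ml Mr) :=
  (isCompact_Icc.prod (isCompact_Icc.prod (isCompact_Icc.prod isCompact_Icc))).inter_right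
    ((isClosed_le (by fun_prop) (by fun_prop)).inter (isClosed_le (by fun_prop) (by fun_prop)))

end SlipRobot

theorem proposition1 (b k₁ k₂ k₃ : ℝ) (vref ωref al ar : ℝ → ℝ)
    (h : SlipRobot.StandingAssumption b k₁ k₂ k₃ vref ωref al ar) :
    -- `A(t)` is the Jacobian of the nominal vector field at the origin
    (∀ γ₁ γ₂ : ℝ, 0 < γ₁ → 0 < γ₂ → ∀ t : ℝ, 0 ≤ t →
      HasFDerivAt (SlipRobot.nominalField b k₁ k₂ k₃ γ₁ γ₂ vref ωref al ar t)
        (LinearMap.toContinuousLinearMap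
          (Matrix.toLin' (SlipRobot.linMatrix b k₁ k₂ k₃ γ₁ γ₂ vref ωref al ar t)))
        (0 : Fin 5 → ℝ)) ∧
    -- for small gains its eigenvalues are bounded away from the imaginary axis, uniformly in `t`
    (∃ γ₀ : ℝ, 0 < γ₀ ∧ ∀ γ₁ γ₂ : ℝ, 0 < γ₁ → γ₁ < γ₀ → 0 < γ₂ → γ₂ < γ₀ →
      ∃ ε : ℝ, 0 < ε ∧ ∀ t : ℝ, 0 ≤ t → ∀ z : ℂ,
        Module.End.HasEigenvalue
          (Matrix.toLin' ((SlipRobot.linMatrix b k₁ k₂ k₃ γ₁ γ₂ vref ωref al ar t).map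
            (fun r : ℝ => (r : ℂ)))) z →
        z.re ≤ -ε) := by
  have hl (t : ℝ) (ht : 0 ≤ t) : 0 < al t := one_pos.trans_le (h.one_le_al t ht)
  have hr (t : ℝ) (ht : 0 ≤ t) : 0 < ar t := one_pos.trans_le (h.one_le_ar t ht)
  refine ⟨fun γ₁ γ₂ _ _ t ht => SlipRobot.hasFDerivAt_nominalField h.b_pos.ne' h.k₂_pos.ne'
    h.k₃_pos.ne' (hl t ht).ne' (hr t ht).ne', ?_⟩
  obtain ⟨μ₁, hμ₁, hv⟩ := h.vref_lower
  obtain ⟨μ₂, hμ₂, hwheel⟩ := h.wheel_lower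
  obtain ⟨Mv, hMv⟩ := h.vref_bdd
  obtain ⟨Mω, hMω⟩ := h.ωref_bdd
  obtain ⟨Ml, hMl⟩ := h.al_bdd
  obtain ⟨Mr, hMr⟩ := h.ar_bdd
  have hMl₀ : 0 < Ml := (hl 0 le_rfl).trans_le ((le_abs_self _).trans (hMl 0 le_rfl))
  have hMr₀ : 0 < Mr := (hr 0 le_rfl).trans_le ((le_abs_self _).trans (hMr 0 le_rfl))
  -- Any positive bound on the gains will do: the Lyapunov argument works for all of them.
  refine ⟨1, one_pos, fun γ₁ γ₂ hγ₁ _ hγ₂ _ => ?_⟩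
  obtain ⟨ε, hε, hbound⟩ := SlipRobot.exists_uniform_re_bound
    (SlipRobot.isCompact_parameterSet b μ₁ μ₂ Mv Mω Ml Mr)
    (SlipRobot.continuous_frozenMatrix b k₁ k₂ k₃ γ₁ γ₂) (by
      rintro ⟨v, ω, α, β⟩ ⟨⟨hv, -, hα, hβ⟩, h₁, h₂⟩ x hx z hz
      exact SlipRobot.re_neg_of_mulVec_eq h.b_pos h.k₁_pos h.k₂_pos h.k₃_pos hγ₁ hγ₂
        (hμ₁.trans_le hv.1) ((inv_pos.mpr hMl₀).trans_le hα.1)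
        ((inv_pos.mpr hMr₀).trans_le hβ.1) (abs_pos.mp (hμ₂.trans_le h₁))
        (abs_pos.mp (hμ₂.trans_le h₂)) hx hz)
  refine ⟨ε, hε, fun t ht z hz => ?_⟩
  obtain ⟨x, hx⟩ := hz.exists_hasEigenvector
  rw [SlipRobot.linMatrix_eq_frozenMatrix h.b_pos.ne' h.k₂_pos.ne' (hl t ht).ne' (hr t ht).ne']
    at hx
  refine hbound (vref t, ωref t, (al t)⁻¹, (ar t)⁻¹) ⟨⟨⟨hv t ht, ?_⟩, ?_, ⟨?_, ?_⟩, ⟨?_, ?_⟩⟩,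
    hwheel t ht⟩ x hx.2 z (by simpa using hx.apply_eq_smul)
  · exact (le_abs_self _).trans (hMv t ht)
  · exact abs_le.mp (hMω t ht)
  · exact inv_anti₀ (hl t ht) ((le_abs_self _).trans (hMl t ht))
  · exact inv_le_one_of_one_le₀ (h.one_le_al t ht)
  · exact inv_anti₀ (hr t ht) ((le_abs_self _).trans (hMr t ht))
  · exact inv_le_one_of_one_le₀ (h.one_le_ar t ht)
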